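/- For an integer $n\ge 0$ and a real number $b$ put $[n]=[n]_b=\frac{b^n-1}{b-1}$ if $b\ne 1$, and $[n]=n$ if $b=1$. A finite distance-regular graph of diameter $d$ has classical parameters $(d,b,\alpha,\beta)$ if its intersection numbers are $b_i=([d]-[i])(\beta-\alpha[i])$ and $c_i=[i](1+\alpha[i-1])$ for $0\le i\le d$ (with $c_0=0$). Put $\theta_i=[d-i](\beta-\alpha[i])-[i]$ for $0\le i\le d$. Fix $(d,b,\alpha)$, with $d\ge 0$ an integer and $b,\alpha$ real. Then there is a number $\beta_0=\beta_0(d,b,\alpha)$ such that the following holds for every distance-regular graph $\Gamma$ with classical parameters $(d,b,\alpha,\beta)$ where $\beta\ge\beta_0$. The numbers $\theta_0,\dots,\theta_d$ are distinct and are precisely the eigenvalues of $\Gamma$, so that the eigenmatrix $P=(P_{ij})_{0\le i,j\le d}$ is well defined, where $P_{ij}$ is the eigenvalue of the distance-$j$ graph of $\Gamma$ on the eigenspace of $\Gamma$ belonging to $\theta_i$; and (i) $P_{ij}>0$ if $i+j\le d$, and $P_{ij}$ is nonzero with sign $(-1)^{i+j-d}$ if $i+j\ge d$ ($0\le i,j\le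 d$); (ii) $P_{d-j+1,j}=\min\{P_{ij}\mid 0\le i\le d\}$ for $1\le j\le d$; (iii) if $b\ge 1$, then $|P_{i+1,j}|<|P_{ij}|$ for $0\le i\le d-1$ and $1\le j\le d$. -/

import Mathlib

/-- The number `[n choose 1]_b`, that is `1 + b + ⋯ + b ^ (n - 1)`. -/
noncomputable def gaussNum (b : ℝ) (n : ℕ) : ℝ :=
  if b = 1 then (n : ℝ) else (b ^ n - 1) / (b - 1)

/-- `G` is a distance-regular graph of diameter `d` with intersection numbers `bs i` and `cs i`:
if `x` and `y` are at distance `i`, then `y` has exactly `bs i` neighbours at distance `i + 1`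
from `x` and exactly `cs i` neighbours at distance `i - 1` from `x`. -/
structure IsDistanceRegular {V : Type*} (G : SimpleGraph V) (d : ℕ) (bs cs : ℕ → ℕ) : Prop where
  connected : G.Connected
  diam_eq : G.diam = d
  card_succ : ∀ x y : V, {z : V | G.Adj y z ∧ G.dist x z = G.dist x y + 1}.ncard = bs (G.dist x y)
  card_pred : ∀ x y : V, {z : V | G.Adj y z ∧ G.dist x z + 1 = G.dist x y}.ncard = cs (G.dist x y)

/-- `G` is a distance-regular graph with classical parameters `(d, b, α, β)`. -/
def HasClassicalParameters {V : Type*} (G : SimpleGraph V) (d : ℕ) (b α β : ℝ) : Prop :=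
  ∃ bs cs : ℕ → ℕ, IsDistanceRegular G d bs cs ∧
    ∀ i ≤ d,
      (bs i : ℝ) = (gaussNum b d - gaussNum b i) * (β - α * gaussNum b i) ∧
      (cs i : ℝ) = gaussNum b i * (1 + α * gaussNum b (i - 1))

/-- The natural ordering `θ 0, …, θ d` of the eigenvalues for classical parameters. -/
noncomputable def classicalEigenvalue (d : ℕ) (b α β : ℝ) (i : ℕ) : ℝ :=
  gaussNum b (d - i) * (β - α * gaussNum b i) - gaussNum b i

/-- The adjacency matrix `A_j` of the distance-`j` graph of `G` (the identity for `j = 0` and the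
adjacency matrix of `G` for `j = 1`, when `G` is connected). -/
noncomputable def distMatrix {V : Type*} (G : SimpleGraph V) (j : ℕ) : Matrix V V ℝ :=
  Matrix.of fun x y => if G.dist x y = j then 1 else 0

open Classical in
/-- `P` is the (first) eigenmatrix of the graph `G` of diameter `d`, with rows ordered by `θ`:
the numbers `θ 0, …, θ d` are distinct, they are precisely the eigenvalues of the adjacency matrix
of `G`, and `P i j` is the eigenvalue of `A_j` on the whole eigenspace belonging to `θ i`. -/
structure IsEigenmatrix {V : Type*} [Fintype V] (G : SimpleGraph V) (d : ℕ) (θ : ℕ → ℝ)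
    (P : Matrix (Fin (d + 1)) (Fin (d + 1)) ℝ) : Prop where
  distinct : ∀ i j : Fin (d + 1), θ i = θ j → i = j
  spectrum : ∀ μ : ℝ,
    Module.End.HasEigenvalue (Matrix.toLin' (G.adjMatrix ℝ)) μ ↔ ∃ i : Fin (d + 1), θ i = μ
  eigen : ∀ i j : Fin (d + 1),
    ∀ v ∈ Module.End.eigenspace (Matrix.toLin' (G.adjMatrix ℝ)) (θ i),
      (distMatrix G j).mulVec v = P i j • v

open Filter Topology

/-! Let b > 0, so that [n] is strictly increasing in n. For an eigenvector v, the sums S_j of v over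
the spheres around a vertex satisfy the three-term recurrence with coefficients b_{j-1}, a_j,
c_{j+1} (`IsEigenSeq`), and row i of P is S_j / S_0. For large β, θ_i ~ [d-i]β, a_j ~ [j]β and b_j ~
([d]-[j])β, while c_j does not depend on β. Run forwards, the recurrence gives S_j / S_0 ~ β^j
∏_{m<j} ([d-i]-[m])/c_{m+1}. This leading coefficient is positive for j ≤ d-i, but contains a zero
factor beyond. Run backwards from S_d, it has a finite limit, a product with one negative factor per
step that is nonzero for the first i steps. The two solutions are glued at j = d-i. So P_{ij} has
exact order β^{min(j, d-i)} with a coefficient of known sign (`tendsto_stableEntry`,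
`entryLim_sign`), and the sign pattern, the minimum and the decrease in absolute value follow by
comparing leading terms. The spectrum is {θ_0, …, θ_d} because adjacency acts on functions of the
distance by a bidiagonal matrix with the θ_n on the diagonal (`distOp_distBasis_succ`). If b ≤ 0 and
d ≥ 2, no such graph exists for large β (`HasClassicalParameters.base_pos`); if d ≤ 1, the
parameters do not depend on b. -/

/-! ### Arithmetic of the numbers [n]. -/

theorem gaussNum_zero (b : ℝ) : gaussNum b 0 = 0 := by
  simp [gaussNum]

theorem gaussNum_succ (b : ℝ) (n : ℕ) : gaussNum b (n + 1) = 1 + b * gaussNum b n := by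
  unfold gaussNum
  split_ifs with h
  · subst h; push_cast; ring
  · have : b - 1 ≠ 0 := sub_ne_zero.2 h
    field_simp
    ring

theorem gaussNum_one (b : ℝ) : gaussNum b 1 = 1 := by
  rw [gaussNum_succ, gaussNum_zero]; ring

theorem gaussNum_two (b : ℝ) : gaussNum b 2 = 1 + b := by
  rw [gaussNum_succ, gaussNum_one]; ring

theorem pow_eq_gaussNum (b : ℝ) (n : ℕ) : b ^ n = 1 + (b - 1) * gaussNum b n := by
  induction n with
  | zero => simp [gaussNum_zero]
  | succ n ih => rw [gaussNum_succ, pow_succ, ih]; ring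

theorem gaussNum_add (b : ℝ) (m n : ℕ) :
    gaussNum b (m + n) = gaussNum b m + b ^ m * gaussNum b n := by
  induction m with
  | zero => simp [gaussNum_zero]
  | succ m ih => rw [Nat.add_right_comm, gaussNum_succ, ih, gaussNum_succ]; ring

theorem gaussNum_strictMono {b : ℝ} (hb : 0 < b) : StrictMono (gaussNum b) := by
  refine strictMono_nat_of_lt_succ fun n => ?_
  rw [gaussNum_add, gaussNum_one]
  have := pow_pos hb n
  linarith

/-! ### The bidiagonal form of adjacency on functions of the distance. -/

/-- The intersection number `b_i` for classical parameters. -/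
noncomputable def classicalB (d : ℕ) (b α β : ℝ) (i : ℕ) : ℝ :=
  (gaussNum b d - gaussNum b i) * (β - α * gaussNum b i)

/-- The intersection number `c_i` for classical parameters. -/
noncomputable def classicalC (b α : ℝ) (i : ℕ) : ℝ :=
  gaussNum b i * (1 + α * gaussNum b (i - 1))

/-- The intersection number `a_i` for classical parameters. -/
noncomputable def classicalA (d : ℕ) (b α β : ℝ) (i : ℕ) : ℝ :=
  classicalB d b α β 0 - classicalB d b α β i - classicalC b α i

/-- The action of the adjacency matrix on functions of the distance to a fixed vertex. -/
noncomputable def distOp (d : ℕ) (b α β : ℝ) (u : ℕ → ℝ) (j : ℕ) : ℝ :=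
  classicalB d b α β j * u (j + 1) + classicalA d b α β j * u j + classicalC b α j * u (j - 1)

/-- A triangular basis for the functions of the distance, on which `distOp` is bidiagonal. -/
noncomputable def distBasis (b : ℝ) (n j : ℕ) : ℝ :=
  ∏ m ∈ Finset.range n, (gaussNum b j - gaussNum b m) / b ^ j

/-- The off-diagonal coefficients of `distOp` in the basis `distBasis`. -/
noncomputable def distCoeff (d : ℕ) (b α β : ℝ) (n : ℕ) : ℝ :=
  classicalB d b α β (n - 1) * gaussNum b n / b ^ n

theorem distBasis_zero (b : ℝ) (j : ℕ) : distBasis b 0 j = 1 := by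
  simp [distBasis]

theorem distBasis_succ (b : ℝ) (n j : ℕ) :
    distBasis b (n + 1) j = distBasis b n j * ((gaussNum b j - gaussNum b n) / b ^ j) :=
  Finset.prod_range_succ _ _

theorem distBasis_eq_zero (b : ℝ) {n j : ℕ} (h : j < n) : distBasis b n j = 0 :=
  Finset.prod_eq_zero (Finset.mem_range.2 h) (by simp)

theorem distBasis_self_ne_zero {b : ℝ} (hb : 0 < b) (n : ℕ) : distBasis b n n ≠ 0 := by
  refine Finset.prod_ne_zero_iff.2 fun m hm => ?_
  have := gaussNum_strictMono hb (Finset.mem_range.1 hm)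
  exact div_ne_zero (by linarith) (pow_pos hb n).ne'

/-- The quotient ([j]-[m]) / b^j is unchanged when j and m both grow by 1; only the factor with m =
0 remains. -/
theorem distBasis_succ_succ {b : ℝ} (hb : b ≠ 0) (n j : ℕ) :
    distBasis b (n + 1) (j + 1) = gaussNum b (j + 1) / b ^ (j + 1) * distBasis b n j := by
  unfold distBasis
  rw [Finset.prod_range_succ', gaussNum_zero, sub_zero, mul_comm]
  congr 1
  refine Finset.prod_congr rfl fun m _ => ?_
  rw [gaussNum_succ, gaussNum_succ, pow_succ]
  field_simp
  ring

theorem distOp_distBasis_zero {d : ℕ} {b α β : ℝ} (j : ℕ) :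
    distOp d b α β (distBasis b 0) j = classicalEigenvalue d b α β 0 * distBasis b 0 j := by
  simp only [distOp, distBasis_zero, classicalA, classicalB, classicalEigenvalue, gaussNum_zero,
    Nat.sub_zero]
  ring

theorem gaussNum_sub {b : ℝ} (hb : b ≠ 0) {d n : ℕ} (h : n ≤ d) :
    gaussNum b (d - n) = (gaussNum b d - gaussNum b n) / b ^ n := by
  obtain ⟨k, rfl⟩ := Nat.exists_eq_add_of_le h
  rw [gaussNum_add, Nat.add_sub_cancel_left]
  field_simp
  ring

/-- The shift identity makes every term a multiple of one common basis value, leaving a rational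
identity in [j], [n], [d] and the powers of b, with b^j = 1 + (b-1)[j]. -/
theorem distOp_distBasis_succ {d : ℕ} {b α β : ℝ} (hb : 0 < b) {n : ℕ} (hn : n + 1 ≤ d) (j : ℕ) :
    distOp d b α β (distBasis b (n + 1)) j =
      classicalEigenvalue d b α β (n + 1) * distBasis b (n + 1) j +
        distCoeff d b α β (n + 1) * distBasis b n j := by
  have hb' := hb.ne'
  rw [distOp, distBasis_succ_succ hb', classicalEigenvalue, gaussNum_sub hb' hn, distCoeff,
    Nat.add_sub_cancel]
  rcases j with _ | j
  · rw [distBasis_eq_zero b (Nat.succ_pos n)]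
    rcases n with _ | n
    · simp [distBasis_zero, classicalC, gaussNum_zero, gaussNum_one, classicalB, div_eq_mul_inv]
    · simp [distBasis_eq_zero b (Nat.succ_pos n), classicalC, gaussNum_zero]
  · rw [distBasis_succ_succ hb']
    rcases n with _ | n
    · simp only [classicalA, classicalB, classicalC, Nat.add_sub_cancel,
        gaussNum_zero, gaussNum_succ, pow_succ, zero_add, distBasis, Finset.prod_range_one]
      have e := pow_eq_gaussNum b j
      have hj : b ^ j ≠ 0 := pow_ne_zero _ hb'
      field_simp
      simp only [e]
      ring
    · rw [distBasis_succ_succ hb', Nat.add_sub_cancel, distBasis_succ b (n + 1) j,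
        distBasis_succ b n j]
      simp only [classicalA, classicalB, classicalC, Nat.add_sub_cancel,
        gaussNum_zero, gaussNum_succ, pow_succ]
      have e := pow_eq_gaussNum b j
      have e' := pow_eq_gaussNum b n
      have hj : b ^ j ≠ 0 := pow_ne_zero _ hb'
      have hn : b ^ n ≠ 0 := pow_ne_zero _ hb'
      generalize distBasis b n j = D
      generalize gaussNum b j = s at *
      generalize gaussNum b n = t at *
      generalize gaussNum b d = g at *
      generalize b ^ j = x at *
      generalize b ^ n = y at *
      field_simp
      subst e e'
      ring

/-! ### Distances and neighbour counts in the graph. -/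

theorem SimpleGraph.Connected.exists_adj_dist_add_one {V : Type*} {G : SimpleGraph V}
    (hG : G.Connected) {x y : V} (h : 0 < G.dist x y) :
    ∃ z, G.Adj y z ∧ G.dist x z + 1 = G.dist x y := by
  obtain ⟨p, hp⟩ := hG.exists_walk_length_eq_dist y x
  rw [G.dist_comm] at hp
  cases p with
  | nil => simp at h
  | @cons _ z _ hz q =>
    refine ⟨z, hz, ?_⟩
    have h1 := G.dist_le q
    rw [SimpleGraph.Walk.length_cons] at hp
    have h2 := hG.dist_triangle (u := x) (v := z) (w := y)
    rw [SimpleGraph.dist_eq_one_iff_adj.2 hz.symm] at h2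
    rw [G.dist_comm] at h1
    omega

theorem SimpleGraph.Connected.exists_dist_eq {V : Type*} {G : SimpleGraph V}
    (hG : G.Connected) {x y : V} {i : ℕ} (h : i ≤ G.dist x y) : ∃ z, G.dist x z = i := by
  induction h using Nat.decreasingInduction with
  | self => exact ⟨y, rfl⟩
  | of_succ k hk ih =>
    obtain ⟨z, hz⟩ := ih
    obtain ⟨w, -, hw⟩ := hG.exists_adj_dist_add_one (x := x) (y := z) (by omega)
    exact ⟨w, by omega⟩

theorem SimpleGraph.Connected.dist_le_diam_of_finite {V : Type*} [Finite V] {G : SimpleGraph V}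
    (hG : G.Connected) (x y : V) : G.dist x y ≤ G.diam := by
  have := hG.nonempty
  exact SimpleGraph.dist_le_diam (SimpleGraph.connected_iff_ediam_ne_top.1 hG)

theorem SimpleGraph.Connected.exists_forall_dist_eq {V : Type*} {G : SimpleGraph V}
    (hG : G.Connected) : ∃ x : V, ∀ i ≤ G.diam, ∃ z, G.dist x z = i := by
  have := hG.nonempty
  obtain ⟨x, y, h⟩ := G.exists_dist_eq_diam
  exact ⟨x, fun i hi => hG.exists_dist_eq (h ▸ hi)⟩

theorem SimpleGraph.Connected.dist_cases_of_adj {V : Type*} {G : SimpleGraph V}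
    (hG : G.Connected) (x : V) {y z : V} (h : G.Adj y z) :
    G.dist x z = G.dist x y + 1 ∨ G.dist x z = G.dist x y ∨ G.dist x z + 1 = G.dist x y := by
  have h1 := hG.dist_triangle (u := x) (v := y) (w := z)
  have h2 := hG.dist_triangle (u := x) (v := z) (w := y)
  rw [SimpleGraph.dist_eq_one_iff_adj.2 h] at h1
  rw [SimpleGraph.dist_eq_one_iff_adj.2 h.symm] at h2
  omega

section Graph

variable {V : Type*} {G : SimpleGraph V} {d : ℕ} {b α β : ℝ}

theorem HasClassicalParameters.connected (h : HasClassicalParameters G d b α β) : G.Connected := by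
  obtain ⟨bs, cs, h, -⟩ := h
  exact h.connected

theorem HasClassicalParameters.diam_eq (h : HasClassicalParameters G d b α β) : G.diam = d := by
  obtain ⟨bs, cs, h, -⟩ := h
  exact h.diam_eq

variable [Fintype V]

-- Every neighbour of y lies at distance k-1, k or k+1 from x, where k is the distance of y; the
-- middle count is the valency minus the other two.
open Classical in
theorem IsDistanceRegular.sum_neighbor {bs cs : ℕ → ℕ} (h : IsDistanceRegular G d bs cs)
    (u : ℕ → ℝ) (x y : V) :
    ∑ z ∈ G.neighborFinset y, u (G.dist x z) =
      bs (G.dist x y) * u (G.dist x y + 1) +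
        ((bs 0 : ℝ) - bs (G.dist x y) - cs (G.dist x y)) * u (G.dist x y) +
        cs (G.dist x y) * u (G.dist x y - 1) := by
  have hdeg : ∑ z ∈ G.neighborFinset y, (1 : ℝ) = bs 0 := by
    have := h.card_succ y y
    rw [SimpleGraph.dist_self] at this
    rw [← this, Finset.sum_const, nsmul_eq_mul, mul_one, ← Set.ncard_coe_finset]
    congr 2
    ext z
    simp
  have hb : ∑ z ∈ G.neighborFinset y, (if G.dist x z = G.dist x y + 1 then (1 : ℝ) else 0)
      = bs (G.dist x y) := by
    rw [← h.card_succ x y, Finset.sum_boole, ← Set.ncard_coe_finset]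
    congr 2
    ext z
    simp
  have hc : ∑ z ∈ G.neighborFinset y, (if G.dist x z + 1 = G.dist x y then (1 : ℝ) else 0)
      = cs (G.dist x y) := by
    rw [← h.card_pred x y, Finset.sum_boole, ← Set.ncard_coe_finset]
    congr 2
    ext z
    simp
  rw [← hdeg, ← hb, ← hc, ← Finset.sum_sub_distrib, ← Finset.sum_sub_distrib, Finset.sum_mul,
    Finset.sum_mul, Finset.sum_mul, ← Finset.sum_add_distrib, ← Finset.sum_add_distrib]
  refine Finset.sum_congr rfl fun z hz => ?_
  rw [SimpleGraph.mem_neighborFinset] at hz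
  rcases h.connected.dist_cases_of_adj x hz with e | e | e
  · rw [if_pos e, if_neg (by omega), e]; ring
  · rw [if_neg (by omega), if_neg (by omega), e]; ring
  · rw [if_neg (by omega), if_pos e, ← e, Nat.add_sub_cancel]; ring

theorem HasClassicalParameters.dist_le (h : HasClassicalParameters G d b α β) (x y : V) :
    G.dist x y ≤ d :=
  (h.connected.dist_le_diam_of_finite x y).trans h.diam_eq.le

open Classical in
theorem HasClassicalParameters.sum_neighbor (h : HasClassicalParameters G d b α β)
    (u : ℕ → ℝ) (x y : V) :
    ∑ z ∈ G.neighborFinset y, u (G.dist x z) = distOp d b α β u (G.dist x y) := by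
  have hd := h.dist_le x y
  obtain ⟨bs, cs, h, hbc⟩ := h
  rw [h.sum_neighbor, (hbc _ hd).1, (hbc _ hd).2, (hbc 0 (Nat.zero_le d)).1]
  rfl

theorem HasClassicalParameters.classicalC_pos (h : HasClassicalParameters G d b α β) {i : ℕ}
    (hi : 0 < i) (hid : i ≤ d) : 0 < classicalC b α i := by
  have hd := h.diam_eq
  obtain ⟨bs, cs, h, hbc⟩ := h
  obtain ⟨x, hx⟩ := h.connected.exists_forall_dist_eq
  obtain ⟨y, hy⟩ := hx i (hd ▸ hid)
  obtain ⟨z, hz⟩ := h.connected.exists_adj_dist_add_one (x := x) (y := y) (by omega)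
  have := h.card_pred x y
  rw [hy] at this
  unfold classicalC
  rw [← (hbc i hid).2, Nat.cast_pos, ← this, Set.ncard_pos]
  exact ⟨z, hz.1, hz.2.trans hy⟩

theorem HasClassicalParameters.classicalB_pos (h : HasClassicalParameters G d b α β) {i : ℕ}
    (hid : i < d) : 0 < classicalB d b α β i := by
  have hd := h.diam_eq
  obtain ⟨bs, cs, h, hbc⟩ := h
  obtain ⟨x, hx⟩ := h.connected.exists_forall_dist_eq
  obtain ⟨y, hy⟩ := hx (i + 1) (hd ▸ hid)
  obtain ⟨z, hz⟩ := h.connected.exists_adj_dist_add_one (x := x) (y := y) (by omega)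
  have := h.card_succ x z
  rw [show G.dist x z = i by omega] at this
  unfold classicalB
  rw [← (hbc i hid.le).1, Nat.cast_pos, ← this, Set.ncard_pos]
  exact ⟨y, hz.1.symm, hy⟩

theorem HasClassicalParameters.classicalA_nonneg (h : HasClassicalParameters G d b α β) {i : ℕ}
    (hid : i ≤ d) : 0 ≤ classicalA d b α β i := by
  classical
  have hd := h.diam_eq
  obtain ⟨x, hx⟩ := h.connected.exists_forall_dist_eq
  obtain ⟨y, hy⟩ := hx i (hd ▸ hid)
  have := h.sum_neighbor (fun j => if j = i then 1 else 0) x y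
  rw [hy, distOp] at this
  -- For i = 0 the truncated `i - 1` is i itself, so the indicator would also pick up the c-term;
  -- here a_0 = 0 directly.
  rcases Nat.eq_zero_or_pos i with rfl | hi
  · simp [classicalA, classicalC, gaussNum_zero]
  · rw [if_neg (by omega), if_pos rfl, if_neg (by omega)] at this
    simp only [mul_zero, zero_add, mul_one, add_zero] at this
    rw [← this]
    exact Finset.sum_nonneg fun z _ => by split_ifs <;> norm_num

end Graph

/-! ### Sphere sums and the spectrum. -/

/-- The linear recurrence satisfied by the sums of an eigenvector over the spheres around a
vertex. -/
structure IsEigenSeq (d : ℕ) (b α β θ : ℝ) (S : ℕ → ℝ) : Prop where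
  zero : θ * S 0 = classicalA d b α β 0 * S 0 + classicalC b α 1 * S 1
  succ : ∀ j, θ * S (j + 1) = classicalB d b α β j * S j +
    classicalA d b α β (j + 1) * S (j + 1) + classicalC b α (j + 2) * S (j + 2)
  vanish : S (d + 1) = 0

theorem sum_mul_distBasis_ne_zero {b : ℝ} (hb : 0 < b) (γ : ℕ → ℝ) (i : ℕ) (hγ : γ i ≠ 0) :
    ∃ j ≤ i, ∑ n ∈ Finset.range (i + 1), γ n * distBasis b n j ≠ 0 := by
  by_contra! h
  have key : ∀ j ≤ i, γ j = 0 := by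
    intro j
    induction j using Nat.strong_induction_on with
    | _ j ih =>
      intro hj
      have := h j hj
      rw [Finset.sum_eq_single j] at this
      · exact (mul_eq_zero.1 this).resolve_right (distBasis_self_ne_zero hb j)
      · intro n hn hne
        rcases lt_or_gt_of_ne hne with hlt | hlt
        · rw [ih n hlt (by omega), zero_mul]
        · rw [distBasis_eq_zero b hlt, mul_zero]
      · intro hn
        exact absurd (Finset.mem_range.2 (by omega)) hn
  exact hγ (key i le_rfl)

theorem distOp_sum (d : ℕ) (b α β : ℝ) (s : Finset ℕ) (γ : ℕ → ℝ) (u : ℕ → ℕ → ℝ) (j : ℕ) :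
    distOp d b α β (fun j => ∑ n ∈ s, γ n * u n j) j = ∑ n ∈ s, γ n * distOp d b α β (u n) j := by
  simp only [distOp, Finset.mul_sum, ← Finset.sum_add_distrib]
  exact Finset.sum_congr rfl fun n _ => by ring

/-- Back-substitution in the bidiagonal system: the coefficients γ_n for n ≤ i start from γ_i = 1,
and distinctness of the θ's allows the divisions. -/
theorem exists_distOp_eigenfunction {d : ℕ} {b α β : ℝ} (hb : 0 < b)
    (hθ : ∀ i ≤ d, ∀ j ≤ d,
      classicalEigenvalue d b α β i = classicalEigenvalue d b α β j → i = j) {i : ℕ} (hi : i ≤ d) :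
    ∃ w : ℕ → ℝ, (∀ j, distOp d b α β w j = classicalEigenvalue d b α β i * w j) ∧
      ∃ j ≤ i, w j ≠ 0 := by
  set γ : ℕ → ℝ := fun n => ∏ m ∈ Finset.Ico n i, distCoeff d b α β (m + 1) /
    (classicalEigenvalue d b α β i - classicalEigenvalue d b α β m) with hγ
  have hγi : γ i = 1 := by simp [hγ]
  have hγs : ∀ n < i, γ n * (classicalEigenvalue d b α β n - classicalEigenvalue d b α β i) =
      -(γ (n + 1) * distCoeff d b α β (n + 1)) := by
    intro n hn
    have h0 : classicalEigenvalue d b α β i - classicalEigenvalue d b α β n ≠ 0 :=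
      sub_ne_zero.2 fun h => by have := hθ i hi n (by omega) h; omega
    simp only [hγ]
    rw [Finset.prod_eq_prod_Ico_succ_bot hn]
    field_simp
    ring
  refine ⟨fun j => ∑ n ∈ Finset.range (i + 1), γ n * distBasis b n j, fun j => ?_,
    sum_mul_distBasis_ne_zero hb γ i (by simp [hγi])⟩
  rw [distOp_sum, ← sub_eq_zero, Finset.mul_sum, ← Finset.sum_sub_distrib]
  -- The off-diagonal contribution of the n-th basis function; with it the residual telescopes.
  set f : ℕ → ℝ := fun n => n.casesOn 0 fun m =>
    γ (m + 1) * distCoeff d b α β (m + 1) * distBasis b m j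
  have hf0 : f 0 = 0 := rfl
  have hfs : ∀ m, f (m + 1) = γ (m + 1) * distCoeff d b α β (m + 1) * distBasis b m j := fun _ => rfl
  have hop : ∀ n ≤ d, γ n * distOp d b α β (distBasis b n) j -
      classicalEigenvalue d b α β i * (γ n * distBasis b n j) =
      γ n * (classicalEigenvalue d b α β n - classicalEigenvalue d b α β i) * distBasis b n j
        + f n := by
    intro n hn
    rcases n with _ | n
    · rw [distOp_distBasis_zero, hf0]; ring
    · rw [distOp_distBasis_succ hb hn, hfs]; ring
  have hterm : ∀ n ∈ Finset.range i, γ n * distOp d b α β (distBasis b n) j -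
      classicalEigenvalue d b α β i * (γ n * distBasis b n j) = f n - f (n + 1) := by
    intro n hn
    have hn := Finset.mem_range.1 hn
    rw [hop n (by omega), hγs n hn, hfs]
    ring
  rw [Finset.sum_range_succ, Finset.sum_congr rfl hterm, Finset.sum_range_sub', hop i hi, sub_self,
    mul_zero, zero_mul, zero_add, sub_add_cancel, hf0]

section Graph

variable {V : Type*} [Fintype V] {G : SimpleGraph V} {d : ℕ} {b α β : ℝ}

open Classical in
theorem mem_eigenspace_adjMatrix {μ : ℝ} {v : V → ℝ} :
    v ∈ Module.End.eigenspace (Matrix.toLin' (G.adjMatrix ℝ)) μ ↔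
      ∀ y, ∑ z ∈ G.neighborFinset y, v z = μ * v y := by
  rw [Module.End.mem_eigenspace_iff, Matrix.toLin'_apply, funext_iff]
  simp [SimpleGraph.adjMatrix_mulVec_apply]

-- Adjacency is symmetric, so it can be moved from u to v.
open Classical in
theorem HasClassicalParameters.sum_mul_distOp (h : HasClassicalParameters G d b α β) {μ : ℝ}
    {v : V → ℝ} (hv : ∀ y, ∑ z ∈ G.neighborFinset y, v z = μ * v y) (u : ℕ → ℝ) (x : V) :
    ∑ y, v y * distOp d b α β u (G.dist x y) = μ * ∑ y, v y * u (G.dist x y) := by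
  have e : ∀ y, v y * distOp d b α β u (G.dist x y) =
      ∑ z, if G.Adj y z then v y * u (G.dist x z) else 0 := by
    intro y
    rw [← h.sum_neighbor, Finset.mul_sum, SimpleGraph.neighborFinset_eq_filter, Finset.sum_filter]
  rw [Finset.sum_congr rfl fun y _ => e y, Finset.sum_comm, Finset.mul_sum]
  refine Finset.sum_congr rfl fun z _ => ?_
  rw [← mul_assoc, ← hv z, SimpleGraph.neighborFinset_eq_filter, Finset.sum_filter, Finset.sum_mul]
  refine Finset.sum_congr rfl fun y _ => ?_
  rw [G.adj_comm]
  split_ifs <;> simp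

theorem distMatrix_mulVec_apply (v : V → ℝ) (j : ℕ) (x : V) :
    (distMatrix G j).mulVec v x = ∑ y, v y * if G.dist x y = j then 1 else 0 := by
  simp [distMatrix, Matrix.mulVec, dotProduct, mul_comm]

theorem SimpleGraph.Connected.distMatrix_zero_mulVec (hG : G.Connected) (v : V → ℝ) :
    (distMatrix G 0).mulVec v = v := by
  classical
  ext x
  simp [distMatrix_mulVec_apply, hG.dist_eq_zero_iff]

-- Pair v with the adjacency image of the indicator of a sphere around x.
open Classical in
theorem HasClassicalParameters.isEigenSeq (h : HasClassicalParameters G d b α β) {μ : ℝ}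
    {v : V → ℝ} (hv : ∀ y, ∑ z ∈ G.neighborFinset y, v z = μ * v y) (x : V) :
    IsEigenSeq d b α β μ fun j => (distMatrix G j).mulVec v x := by
  refine ⟨?_, fun j => ?_, ?_⟩
  · simp only [distMatrix_mulVec_apply]
    rw [← h.sum_mul_distOp hv (fun i => if i = 0 then 1 else 0) x, Finset.mul_sum, Finset.mul_sum,
      ← Finset.sum_add_distrib]
    refine Finset.sum_congr rfl fun y _ => ?_
    generalize G.dist x y = i
    rcases i with _ | _ | i <;> simp [distOp, classicalC, gaussNum_zero] <;> ring
  · simp only [distMatrix_mulVec_apply]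
    rw [← h.sum_mul_distOp hv (fun i => if i = j + 1 then 1 else 0) x, Finset.mul_sum,
      Finset.mul_sum, Finset.mul_sum, ← Finset.sum_add_distrib, ← Finset.sum_add_distrib]
    refine Finset.sum_congr rfl fun y _ => ?_
    generalize G.dist x y = i
    have e1 : (i - 1 = j + 1) ↔ i = j + 2 := by omega
    have e2 : (i + 1 = j + 1) ↔ i = j := by omega
    simp only [distOp, e1, e2]
    rcases eq_or_ne i j with rfl | h1
    · simp; ring
    rcases eq_or_ne i (j + 1) with rfl | h2
    · simp; ring
    rcases eq_or_ne i (j + 2) with rfl | h3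
    · simp; ring
    simp [h1, h2, h3]
  · rw [distMatrix_mulVec_apply]
    refine Finset.sum_eq_zero fun y _ => ?_
    rw [if_neg (by have := h.dist_le x y; omega), mul_zero]

open Classical in
theorem HasClassicalParameters.exists_eigenvalue_eq (h : HasClassicalParameters G d b α β)
    (hb : 0 < b) {μ : ℝ} {v : V → ℝ} (hv : ∀ y, ∑ z ∈ G.neighborFinset y, v z = μ * v y)
    (h0 : v ≠ 0) : ∃ i ≤ d, classicalEigenvalue d b α β i = μ := by
  by_contra! hμ
  refine h0 (funext fun x => ?_)
  -- Pairing with the basis gives (μ - θ_n) U_n = `distCoeff` · U_{n-1}, so all U_n vanish when μ is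
  -- none of the θ's.
  have hU : ∀ n ≤ d, ∑ y, v y * distBasis b n (G.dist x y) = 0 := by
    intro n
    induction n with
    | zero =>
      intro hn
      have := h.sum_mul_distOp hv (distBasis b 0) x
      simp only [distOp_distBasis_zero, mul_left_comm (v _)] at this
      rw [← Finset.mul_sum] at this
      by_contra hne
      exact hμ 0 hn (mul_right_cancel₀ hne this)
    | succ n ih =>
      intro hn
      have := h.sum_mul_distOp hv (distBasis b (n + 1)) x
      simp only [distOp_distBasis_succ hb hn, mul_add, mul_left_comm (v _)] at this
      rw [Finset.sum_add_distrib, ← Finset.mul_sum, ← Finset.mul_sum, ih (by omega), mul_zero,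
        add_zero] at this
      by_contra hne
      exact hμ _ hn (mul_right_cancel₀ hne this)
  have hS : ∀ k ≤ d, ∑ y, v y * (if G.dist x y = k then (1 : ℝ) else 0) = 0 := by
    intro k hk
    -- U_k involves only spheres of radius at least k, with nonzero coefficient at k, so the sphere
    -- sums vanish from the outermost inwards; radius 0 gives v x = 0.
    induction k using Nat.strong_decreasing_induction with
    | base => exact ⟨d, fun m hm _ => by omega⟩
    | step k ih =>
      have e : ∀ y, v y * distBasis b k (G.dist x y) =
          ∑ j ∈ Finset.Icc k d,
            distBasis b k j * (v y * if G.dist x y = j then 1 else 0) := by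
        intro y
        by_cases hy : k ≤ G.dist x y
        · rw [Finset.sum_eq_single (G.dist x y)]
          · simp [mul_comm]
          · intro j _ hj
            simp [hj.symm]
          · intro hj
            exact absurd (Finset.mem_Icc.2 ⟨hy, h.dist_le x y⟩) hj
        · rw [distBasis_eq_zero b (by omega), mul_zero, Finset.sum_eq_zero]
          intro j hj
          rw [if_neg (by have := Finset.mem_Icc.1 hj; omega), mul_zero, mul_zero]
      have := hU k hk
      rw [Finset.sum_congr rfl fun y _ => e y, Finset.sum_comm,
        Finset.sum_eq_single_of_mem k (Finset.mem_Icc.2 ⟨le_rfl, hk⟩), ← Finset.mul_sum] at this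
      · exact (mul_eq_zero.1 this).resolve_left (distBasis_self_ne_zero hb k)
      · intro j hj hne
        have := Finset.mem_Icc.1 hj
        rw [← Finset.mul_sum, ih j (by omega) this.2, mul_zero]
  have := hS 0 (Nat.zero_le d)
  rwa [← distMatrix_mulVec_apply, h.connected.distMatrix_zero_mulVec] at this

open Classical in
theorem HasClassicalParameters.hasEigenvalue_iff (h : HasClassicalParameters G d b α β)
    (hb : 0 < b) (hθ : ∀ i ≤ d, ∀ j ≤ d,
      classicalEigenvalue d b α β i = classicalEigenvalue d b α β j → i = j) (μ : ℝ) :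
    Module.End.HasEigenvalue (Matrix.toLin' (G.adjMatrix ℝ)) μ ↔
      ∃ i ≤ d, classicalEigenvalue d b α β i = μ := by
  constructor
  · intro hμ
    obtain ⟨v, hv, h0⟩ := hμ.exists_hasEigenvector
    exact h.exists_eigenvalue_eq hb (mem_eigenspace_adjMatrix.1 hv) h0
  · rintro ⟨i, hi, rfl⟩
    obtain ⟨w, hw, j, hj, hwj⟩ := exists_distOp_eigenfunction hb hθ hi
    obtain ⟨x, hx⟩ := h.connected.exists_forall_dist_eq
    refine Module.End.hasEigenvalue_of_hasEigenvector (x := fun y => w (G.dist x y)) ⟨?_, ?_⟩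
    · rw [mem_eigenspace_adjMatrix]
      intro y
      rw [h.sum_neighbor, hw]
    · intro h0
      obtain ⟨z, rfl⟩ := hx j (by rw [h.diam_eq]; omega)
      exact hwj (congrFun h0 z)

end Graph

/-! ### Solving the recurrence from either end. -/

section Recurrence

variable (d : ℕ) (b α : ℝ) (β : ℝ) (i : ℕ)

/-- The solution with initial value `1` of the recurrence in `IsEigenSeq` for `θ_i`. -/
noncomputable def forwardSeq : ℕ → ℝ
  | 0 => 1
  | 1 => (classicalEigenvalue d b α β i - classicalA d b α β 0) / classicalC b α 1
  | j + 2 => ((classicalEigenvalue d b α β i - classicalA d b α β (j + 1)) * forwardSeq (j + 1) -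
      classicalB d b α β j * forwardSeq j) / classicalC b α (j + 2)

/-- The solution with last value `1`, read backwards, of the recurrence in `IsEigenSeq` for
`θ_i`. -/
noncomputable def backwardSeq : ℕ → ℝ
  | 0 => 1
  | 1 => (classicalEigenvalue d b α β i - classicalA d b α β d) / classicalB d b α β (d - 1)
  | k + 2 => ((classicalEigenvalue d b α β i - classicalA d b α β (d - (k + 1))) *
      backwardSeq (k + 1) - classicalC b α (d - k) * backwardSeq k) /
        classicalB d b α β (d - (k + 2))

variable {d b α β i} {S : ℕ → ℝ}

theorem IsEigenSeq.eq_forwardSeq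
    (h : IsEigenSeq d b α β (classicalEigenvalue d b α β i) S)
    (hC : ∀ j, 0 < j → j ≤ d → 0 < classicalC b α j) :
    ∀ j ≤ d, S j = forwardSeq d b α β i j * S 0 := by
  intro j
  induction j using Nat.twoStepInduction with
  | zero => simp [forwardSeq]
  | one =>
    intro hj
    have := (hC 1 one_pos hj).ne'
    rw [forwardSeq]
    field_simp
    linear_combination -h.zero
  | more j ih1 ih2 =>
    intro hj
    have := (hC (j + 2) (by omega) hj).ne'
    have e := h.succ j
    rw [ih1 (by omega), ih2 (by omega)] at e
    rw [forwardSeq]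
    field_simp
    linear_combination -e

theorem IsEigenSeq.eq_backwardSeq
    (h : IsEigenSeq d b α β (classicalEigenvalue d b α β i) S)
    (hB : ∀ j < d, classicalB d b α β j ≠ 0) :
    ∀ k ≤ d, S (d - k) = backwardSeq d b α β i k * S d := by
  intro k
  induction k using Nat.twoStepInduction with
  | zero => simp [backwardSeq]
  | one =>
    intro hk
    have := hB (d - 1) (by omega)
    have e := h.succ (d - 1)
    rw [show d - 1 + 1 = d by omega, show d - 1 + 2 = d + 1 by omega, h.vanish] at e
    rw [backwardSeq]
    field_simp
    linear_combination -e
  | more k ih1 ih2 =>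
    intro hk
    have := hB (d - (k + 2)) (by omega)
    have e := h.succ (d - (k + 2))
    rw [show d - (k + 2) + 1 = d - (k + 1) by omega, show d - (k + 2) + 2 = d - k by omega,
      ih1 (by omega), ih2 (by omega)] at e
    rw [backwardSeq]
    field_simp
    linear_combination -e

end Recurrence

/-! ### Leading behaviour of both solutions for large β. -/

section Limits

theorem tendsto_linear_div (p q : ℝ) : Tendsto (fun β : ℝ => (p * β + q) / β) atTop (𝓝 p) := by
  have h : Tendsto (fun β : ℝ => p + q * β⁻¹) atTop (𝓝 (p + q * 0)) :=
    tendsto_const_nhds.add (tendsto_inv_atTop_zero.const_mul q)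
  rw [mul_zero, add_zero] at h
  refine h.congr' ?_
  filter_upwards [eventually_ne_atTop 0] with β hβ
  field_simp

theorem tendsto_div_pow_of_lt {f : ℝ → ℝ} {l : ℝ} {m n : ℕ}
    (hf : Tendsto (fun β => f β / β ^ n) atTop (𝓝 l)) (h : n < m) :
    Tendsto (fun β => f β / β ^ m) atTop (𝓝 0) := by
  have h1 : Tendsto (fun β : ℝ => (β ^ (m - n))⁻¹) atTop (𝓝 0) :=
    tendsto_inv_atTop_zero.comp (tendsto_pow_atTop (by omega))
  have := hf.mul h1
  rw [mul_zero] at this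
  refine this.congr fun β => ?_
  rw [← div_eq_mul_inv, div_div, ← pow_add, Nat.add_sub_cancel' h.le]

theorem eventually_forall_le {p : ℕ → ℝ → Prop} (d : ℕ) (h : ∀ i ≤ d, ∀ᶠ β in atTop, p i β) :
    ∀ᶠ β in atTop, ∀ i ≤ d, p i β := by
  simpa using (eventually_all_finset (Finset.Iic d)).2 fun i hi => h i (Finset.mem_Iic.1 hi)

variable (d : ℕ) (b α : ℝ) (i : ℕ)

theorem tendsto_classicalB (j : ℕ) : Tendsto (fun β => classicalB d b α β j / β) atTop
    (𝓝 (gaussNum b d - gaussNum b j)) := by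
  refine (tendsto_linear_div _
    (-((gaussNum b d - gaussNum b j) * (α * gaussNum b j)))).congr fun β => ?_
  rw [classicalB]
  ring

theorem tendsto_classicalA (j : ℕ) : Tendsto (fun β => classicalA d b α β j / β) atTop
    (𝓝 (gaussNum b j)) := by
  refine (tendsto_linear_div _ ((gaussNum b d - gaussNum b j) * (α * gaussNum b j) -
    classicalC b α j)).congr fun β => ?_
  rw [classicalA, classicalB, classicalB, gaussNum_zero]
  ring

theorem tendsto_classicalEigenvalue : Tendsto (fun β => classicalEigenvalue d b α β i / β) atTop
    (𝓝 (gaussNum b (d - i))) := by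
  refine (tendsto_linear_div _ (-(gaussNum b (d - i) * (α * gaussNum b i)) -
    gaussNum b i)).congr fun β => ?_
  rw [classicalEigenvalue]
  ring

/-- The leading coefficient in `β` of `forwardSeq`. -/
noncomputable def forwardLim (j : ℕ) : ℝ :=
  ∏ m ∈ Finset.range j, (gaussNum b (d - i) - gaussNum b m) / classicalC b α (m + 1)

/-- The limit of `backwardSeq` for large `β`. -/
noncomputable def backwardLim (k : ℕ) : ℝ :=
  ∏ m ∈ Finset.range k,
    (gaussNum b (d - i) - gaussNum b (d - m)) / (gaussNum b d - gaussNum b (d - (m + 1)))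

/-- After division by β^{j+2} the term b_j S_j is of order 1/β, so only (θ_i - a_{j+1}) S_{j+1}
contributes to the limit. -/
theorem tendsto_forwardSeq (j : ℕ) :
    Tendsto (fun β => forwardSeq d b α β i j / β ^ j) atTop (𝓝 (forwardLim d b α i j)) := by
  have hθA : ∀ j, Tendsto (fun β => classicalEigenvalue d b α β i / β - classicalA d b α β j / β)
      atTop (𝓝 (gaussNum b (d - i) - gaussNum b j)) := fun j =>
    (tendsto_classicalEigenvalue d b α i).sub (tendsto_classicalA d b α j)
  induction j using Nat.twoStepInduction with
  | zero => simp [forwardSeq, forwardLim]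
  | one =>
    rw [forwardLim, Finset.prod_range_one]
    refine ((hθA 0).div_const (classicalC b α (0 + 1))).congr fun β => ?_
    rw [forwardSeq, pow_one, zero_add]
    ring
  | more j ih1 ih2 =>
    have h1 := (((hθA (j + 1)).mul ih2).sub
      (((tendsto_classicalB d b α j).mul ih1).mul tendsto_inv_atTop_zero)).div_const
        (classicalC b α (j + 2))
    rw [mul_zero, sub_zero] at h1
    have e : forwardLim d b α i (j + 2) = (gaussNum b (d - i) - gaussNum b (j + 1)) *
        forwardLim d b α i (j + 1) / classicalC b α (j + 2) := by
      rw [forwardLim, Finset.prod_range_succ, ← forwardLim]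
      ring
    rw [e]
    refine h1.congr' ?_
    filter_upwards [eventually_ne_atTop 0] with β hβ
    rw [forwardSeq]
    generalize classicalC b α (j + 2) = c
    rw [← sub_div, div_mul_div_comm, div_mul_div_comm, ← pow_succ', ← pow_succ', ← div_eq_mul_inv,
      div_div, ← pow_succ, ← sub_div, div_right_comm]

/-- Division by b_{d-k-2}, of order β, removes the c-term in the limit. -/
theorem tendsto_backwardSeq {b : ℝ} (hb : 0 < b) (k : ℕ) (hk : k ≤ d) :
    Tendsto (fun β => backwardSeq d b α β i k) atTop (𝓝 (backwardLim d b i k)) := by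
  have hθA : ∀ j, Tendsto (fun β => classicalEigenvalue d b α β i / β - classicalA d b α β j / β)
      atTop (𝓝 (gaussNum b (d - i) - gaussNum b j)) := fun j =>
    (tendsto_classicalEigenvalue d b α i).sub (tendsto_classicalA d b α j)
  have hg : ∀ k < d, gaussNum b d - gaussNum b (d - (k + 1)) ≠ 0 := fun k hk =>
    (sub_pos.2 (gaussNum_strictMono hb (by omega))).ne'
  induction k using Nat.twoStepInduction with
  | zero => simp [backwardSeq, backwardLim]
  | one =>
    rw [backwardLim, Finset.prod_range_one]
    refine ((hθA (d - 0)).div (tendsto_classicalB d b α (d - (0 + 1))) (hg 0 hk)).congr' ?_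
    filter_upwards [eventually_ne_atTop 0] with β hβ
    rw [backwardSeq, Pi.div_apply, ← sub_div, div_div_div_cancel_right₀ hβ]
    simp
  | more k ih1 ih2 =>
    have h1 := (((hθA (d - (k + 1))).mul (ih2 (by omega))).sub
      (((ih1 (by omega)).const_mul (classicalC b α (d - k))).mul tendsto_inv_atTop_zero)).div
        (tendsto_classicalB d b α (d - (k + 2))) (hg (k + 1) hk)
    rw [mul_zero, sub_zero] at h1
    have e : backwardLim d b i (k + 2) = (gaussNum b (d - i) - gaussNum b (d - (k + 1))) *
        backwardLim d b i (k + 1) / (gaussNum b d - gaussNum b (d - (k + 2))) := by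
      rw [backwardLim, Finset.prod_range_succ, ← backwardLim]
      ring
    rw [e]
    refine h1.congr' ?_
    filter_upwards [eventually_ne_atTop 0] with β hβ
    rw [backwardSeq, Pi.div_apply, ← sub_div, div_mul_eq_mul_div, ← div_eq_mul_inv, ← sub_div,
      div_div_div_cancel_right₀ hβ]

variable {d b α i}

theorem forwardLim_pos (hb : 0 < b) (hC : ∀ j, 0 < j → j ≤ d → 0 < classicalC b α j) {j : ℕ}
    (hij : i + j ≤ d) : 0 < forwardLim d b α i j := by
  refine Finset.prod_pos fun m hm => div_pos (sub_pos.2 (gaussNum_strictMono hb ?_))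
    (hC _ (Nat.succ_pos m) ?_) <;> have := Finset.mem_range.1 hm <;> omega

theorem forwardLim_succ_lt (hb : 0 < b) (hC : ∀ j, 0 < j → j ≤ d → 0 < classicalC b α j) {j : ℕ}
    (hj : 0 < j) (hij : i + 1 + j ≤ d) : forwardLim d b α (i + 1) j < forwardLim d b α i j := by
  refine Finset.prod_lt_prod_of_nonempty (fun m hm => ?_) (fun m hm => ?_)
    (Finset.nonempty_range_iff.2 hj.ne') <;> have hm := Finset.mem_range.1 hm
  · exact div_pos (sub_pos.2 (gaussNum_strictMono hb (by omega))) (hC _ (Nat.succ_pos m) (by omega))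
  · have := gaussNum_strictMono hb (show d - (i + 1) < d - i by omega)
    exact div_lt_div_of_pos_right (by linarith) (hC _ (Nat.succ_pos m) (by omega))

theorem backwardLim_sign (hb : 0 < b) {k : ℕ} (hk : k ≤ i) (hi : i ≤ d) :
    0 < (-1) ^ k * backwardLim d b i k := by
  have : (-1) ^ k * backwardLim d b i k = ∏ m ∈ Finset.range k,
      (gaussNum b (d - m) - gaussNum b (d - i)) / (gaussNum b d - gaussNum b (d - (m + 1))) := by
    rw [backwardLim, ← Finset.card_range k, ← Finset.prod_const, Finset.card_range,
      ← Finset.prod_mul_distrib]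
    exact Finset.prod_congr rfl fun m _ => by ring
  rw [this]
  refine Finset.prod_pos fun m hm => div_pos (sub_pos.2 (gaussNum_strictMono hb ?_))
    (sub_pos.2 (gaussNum_strictMono hb ?_)) <;> have := Finset.mem_range.1 hm <;> omega

end Limits

/-! ### Orders and signs of the entries of P. -/

section Asymptotics

variable {d : ℕ} {b α : ℝ}

/-- The entry of the eigenmatrix, expressed by the recurrences in the direction in which they
are stable for large `β`. -/
noncomputable def stableEntry (d : ℕ) (b α β : ℝ) (i j : ℕ) : ℝ :=
  if i + j ≤ d then forwardSeq d b α β i j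
  else backwardSeq d b α β i (d - j) / backwardSeq d b α β i i * forwardSeq d b α β i (d - i)

/-- The leading coefficient in `β` of `stableEntry`. -/
noncomputable def entryLim (d : ℕ) (b α : ℝ) (i j : ℕ) : ℝ :=
  if i + j ≤ d then forwardLim d b α i j
  else backwardLim d b i (d - j) / backwardLim d b i i * forwardLim d b α i (d - i)

theorem backwardLim_ne_zero (hb : 0 < b) {i k : ℕ} (hk : k ≤ i) (hi : i ≤ d) :
    backwardLim d b i k ≠ 0 := fun h => by
  simpa [h] using backwardLim_sign hb hk hi

theorem tendsto_stableEntry (hb : 0 < b) {i j : ℕ} (hi : i ≤ d) :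
    Tendsto (fun β => stableEntry d b α β i j / β ^ min j (d - i)) atTop
      (𝓝 (entryLim d b α i j)) := by
  unfold stableEntry entryLim
  split_ifs with h
  · rw [min_eq_left (by omega)]
    exact tendsto_forwardSeq d b α i j
  · rw [min_eq_right (by omega)]
    simp only [mul_div_assoc]
    exact ((tendsto_backwardSeq d α i hb _ (by omega)).div
      (tendsto_backwardSeq d α i hb _ hi) (backwardLim_ne_zero hb le_rfl hi)).mul
        (tendsto_forwardSeq d b α i _)

theorem entryLim_sign (hb : 0 < b) (hC : ∀ j, 0 < j → j ≤ d → 0 < classicalC b α j) {i j : ℕ}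
    (hi : i ≤ d) (hj : j ≤ d) : 0 < (-1) ^ (i + j - d) * entryLim d b α i j := by
  unfold entryLim
  split_ifs with h
  · rw [Nat.sub_eq_zero_of_le h, pow_zero, one_mul]
    exact forwardLim_pos hb hC h
  · have h1 := backwardLim_sign hb (show d - j ≤ i by omega) hi
    have h2 := backwardLim_sign hb le_rfl hi
    have h3 := forwardLim_pos hb hC (show i + (d - i) ≤ d by omega)
    -- The exponents i+j-d and (d-j)+i differ by the even number 2(d-j).
    have e : ((-1 : ℝ)) ^ (i + j - d) = (-1) ^ (d - j) * (-1) ^ i := by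
      rw [← pow_add, show d - j + i = (i + j - d) + 2 * (d - j) by omega, pow_add, pow_mul]
      simp
    have hs : ((-1 : ℝ)) ^ i * (-1) ^ i = 1 := by rw [← mul_pow]; simp
    have := mul_pos (div_pos h1 h2) h3
    refine this.trans_eq ?_
    rw [e]
    have h4 := backwardLim_ne_zero hb le_rfl hi
    have h5 : ((-1 : ℝ)) ^ i ≠ 0 := pow_ne_zero _ (by norm_num)
    field_simp
    rw [pow_two, hs, mul_one]

/-- Beyond j = d-i, the unknown S_d cancels in S_j / S_{d-i}, a ratio of backward solutions. -/
theorem eventually_eq_stableEntry (hb : 0 < b)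
    (hC : ∀ j, 0 < j → j ≤ d → 0 < classicalC b α j) :
    ∀ᶠ β in atTop, ∀ i ≤ d, ∀ S : ℕ → ℝ, S 0 = 1 →
      IsEigenSeq d b α β (classicalEigenvalue d b α β i) S →
        ∀ j ≤ d, S j = stableEntry d b α β i j := by
  have hB : ∀ᶠ β in atTop, ∀ j ≤ d, j < d → classicalB d b α β j ≠ 0 := by
    refine eventually_forall_le d fun j _ => ?_
    by_cases hj : j < d
    · have := (tendsto_classicalB d b α j).eventually_ne
        (sub_pos.2 (gaussNum_strictMono hb hj)).ne'
      filter_upwards [this] with β hβ _ h0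
      simp [h0] at hβ
    · exact Eventually.of_forall fun β h => absurd h hj
  have hb' : ∀ᶠ β in atTop, ∀ i ≤ d, backwardSeq d b α β i i ≠ 0 :=
    eventually_forall_le d fun i hi =>
      (tendsto_backwardSeq d α i hb i hi).eventually_ne (backwardLim_ne_zero hb le_rfl hi)
  filter_upwards [hB, hb'] with β hB hb' i hi S hS0 hS j hj
  have hf := hS.eq_forwardSeq hC
  have hw := hS.eq_backwardSeq fun j hj => hB j hj.le hj
  rw [hS0] at hf
  simp only [mul_one] at hf
  unfold stableEntry
  split_ifs with h
  · exact hf j hj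
  · have h1 := hw (d - j) (by omega)
    have h2 := hw i hi
    have := hb' i hi
    rw [Nat.sub_sub_self hj] at h1
    rw [← hf (d - i) (by omega), h1, h2]
    field_simp

theorem eventually_stableEntry_sign (hb : 0 < b)
    (hC : ∀ j, 0 < j → j ≤ d → 0 < classicalC b α j) :
    ∀ᶠ β in atTop, ∀ i ≤ d, ∀ j ≤ d, 0 < (-1) ^ (i + j - d) * stableEntry d b α β i j := by
  refine eventually_forall_le d fun i hi => eventually_forall_le d fun j hj => ?_
  filter_upwards [((tendsto_stableEntry (α := α) (j := j) hb hi).const_mul _).eventually_const_lt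
    (entryLim_sign hb hC hi hj), eventually_gt_atTop 0] with β h hβ
  rw [← mul_div_assoc] at h
  exact (div_pos_iff_of_pos_right (pow_pos hβ _)).1 h

theorem eventually_stableEntry_min (hb : 0 < b)
    (hC : ∀ j, 0 < j → j ≤ d → 0 < classicalC b α j) :
    ∀ᶠ β in atTop, ∀ i ≤ d, ∀ j ≤ d, 0 < j →
      stableEntry d b α β (d + 1 - j) j ≤ stableEntry d b α β i j := by
  refine eventually_forall_le d fun i hi => eventually_forall_le d fun j hj => ?_
  rcases Nat.eq_zero_or_pos j with rfl | h0
  · exact Eventually.of_forall fun β h => absurd h (lt_irrefl _)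
  have hm : d + 1 - j ≤ d := by omega
  have hneg := entryLim_sign hb hC hm hj
  rw [show d + 1 - j + j - d = 1 by omega, pow_one, neg_one_mul, neg_pos] at hneg
  -- Rows above d+1-j have a positive entry, against a negative one in row d+1-j, of exact order
  -- β^{j-1}; rows below have order β^{d-i} with d-i < j-1.
  rcases lt_trichotomy i (d + 1 - j) with h | rfl | h
  · filter_upwards [eventually_stableEntry_sign hb hC] with β hβ _
    have h1 := hβ i hi j hj
    have h2 := hβ _ hm j hj
    rw [Nat.sub_eq_zero_of_le (by omega), pow_zero, one_mul] at h1
    rw [show d + 1 - j + j - d = 1 by omega, pow_one, neg_one_mul, neg_pos] at h2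
    exact (h2.trans h1).le
  · exact Eventually.of_forall fun β _ => le_rfl
  · have h1 := tendsto_stableEntry (α := α) (j := j) hb hm
    have h2 := tendsto_div_pow_of_lt (tendsto_stableEntry (α := α) (j := j) hb hi)
      (show min j (d - i) < min j (d - (d + 1 - j)) by omega)
    filter_upwards [h1.eventually_lt h2 hneg, eventually_gt_atTop 0] with β h hβ _
    exact ((div_lt_div_iff_of_pos_right (pow_pos hβ _)).1 h).le

theorem eventually_stableEntry_abs_lt (hb : 0 < b)
    (hC : ∀ j, 0 < j → j ≤ d → 0 < classicalC b α j) :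
    ∀ᶠ β in atTop, ∀ i ≤ d, ∀ j ≤ d, i < d → 0 < j →
      |stableEntry d b α β (i + 1) j| < |stableEntry d b α β i j| := by
  refine eventually_forall_le d fun i hi => eventually_forall_le d fun j hj => ?_
  by_cases h : i < d ∧ 0 < j
  swap
  · exact Eventually.of_forall fun β h1 h2 => absurd ⟨h1, h2⟩ h
  obtain ⟨hid, hj0⟩ := h
  have h1 := (tendsto_stableEntry (α := α) (j := j) hb hi).abs
  have key : ∃ l, Tendsto (fun β => stableEntry d b α β (i + 1) j / β ^ min j (d - i)) atTop (𝓝 l) ∧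
      |l| < |entryLim d b α i j| := by
    -- If i+1+j ≤ d, both entries have order β^j and the coefficients decide; otherwise the order
    -- drops by one from row i to row i+1.
    by_cases hij : i + 1 + j ≤ d
    · refine ⟨entryLim d b α (i + 1) j, ?_, ?_⟩
      · rw [show min j (d - i) = min j (d - (i + 1)) by omega]
        exact tendsto_stableEntry hb hid
      · rw [entryLim, entryLim, if_pos hij, if_pos (by omega), abs_of_pos (forwardLim_pos hb hC hij),
          abs_of_pos (forwardLim_pos hb hC (by omega))]
        exact forwardLim_succ_lt hb hC hj0 hij
    · refine ⟨0, tendsto_div_pow_of_lt (tendsto_stableEntry hb hid) (by omega), ?_⟩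
      rw [abs_zero, abs_pos]
      intro h0
      simpa [h0] using entryLim_sign hb hC hi hj
  obtain ⟨l, hl, hlt⟩ := key
  filter_upwards [hl.abs.eventually_lt h1 hlt, eventually_gt_atTop 0] with β h hβ _ _
  rw [abs_div, abs_div] at h
  exact (div_lt_div_iff_of_pos_right (abs_pos.2 (pow_pos hβ _).ne')).1 h

theorem eventually_classicalEigenvalue_injOn (α : ℝ) (d : ℕ) (hb : 0 < b) :
    ∀ᶠ β in atTop, ∀ i ≤ d, ∀ j ≤ d,
      classicalEigenvalue d b α β i = classicalEigenvalue d b α β j → i = j := by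
  refine eventually_forall_le d fun i hi => eventually_forall_le d fun j hj => ?_
  by_cases h : i = j
  · exact Eventually.of_forall fun β _ => h
  have hne : gaussNum b (d - i) - gaussNum b (d - j) ≠ 0 :=
    sub_ne_zero.2 fun e => h (by have := (gaussNum_strictMono hb).injective e; omega)
  filter_upwards [((tendsto_classicalEigenvalue d b α i).sub
    (tendsto_classicalEigenvalue d b α j)).eventually_ne hne] with β hβ e
  rw [e, sub_self] at hβ
  exact absurd rfl hβ

end Asymptotics

/-! ### Eigenmatrices, small diameter and nonpositive base. -/

theorem gaussNum_congr_of_le_one (b b' : ℝ) {i : ℕ} (hi : i ≤ 1) : gaussNum b i = gaussNum b' i := by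
  rcases Nat.le_one_iff_eq_zero_or_eq_one.1 hi with rfl | rfl
  · rw [gaussNum_zero, gaussNum_zero]
  · rw [gaussNum_one, gaussNum_one]

theorem classicalEigenvalue_congr_of_le_one {d : ℕ} (hd : d ≤ 1) (b b' α β : ℝ) {i : ℕ} (hi : i ≤ d) :
    classicalEigenvalue d b α β i = classicalEigenvalue d b' α β i := by
  rw [classicalEigenvalue, classicalEigenvalue, gaussNum_congr_of_le_one b b' (hi.trans hd),
    gaussNum_congr_of_le_one b b' (show d - i ≤ 1 by omega)]

section Eigenmatrix

variable {V : Type*} {G : SimpleGraph V} {d : ℕ} {b α β : ℝ}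

theorem HasClassicalParameters.congr_of_le_one (h : HasClassicalParameters G d b α β) (hd : d ≤ 1)
    (b' : ℝ) : HasClassicalParameters G d b' α β := by
  obtain ⟨bs, cs, h, hbc⟩ := h
  refine ⟨bs, cs, h, fun i hi => ?_⟩
  rw [gaussNum_congr_of_le_one b' b hd, gaussNum_congr_of_le_one b' b (hi.trans hd),
    gaussNum_congr_of_le_one b' b (show i - 1 ≤ 1 by omega)]
  exact hbc i hi

variable [Fintype V]

theorem IsEigenmatrix.exists_eigenvector {θ : ℕ → ℝ} {P : Matrix (Fin (d + 1)) (Fin (d + 1)) ℝ}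
    (h : IsEigenmatrix G d θ P) (i : Fin (d + 1)) :
    ∃ v : V → ℝ, v ≠ 0 ∧ (∀ j : Fin (d + 1), (distMatrix G j).mulVec v = P i j • v) ∧
      ∀ (y : V) [Fintype (G.neighborSet y)], ∑ z ∈ G.neighborFinset y, v z = θ i * v y := by
  classical
  obtain ⟨v, hv, h0⟩ := ((h.spectrum (θ i)).2 ⟨i, rfl⟩).exists_hasEigenvector
  refine ⟨v, h0, fun j => h.eigen i j v hv, fun y _ => ?_⟩
  rw [← mem_eigenspace_adjMatrix.1 hv y]
  congr!

theorem IsEigenmatrix.unique {θ : ℕ → ℝ} {P Q : Matrix (Fin (d + 1)) (Fin (d + 1)) ℝ}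
    (hP : IsEigenmatrix G d θ P) (hQ : IsEigenmatrix G d θ Q) : P = Q := by
  classical
  ext i j
  obtain ⟨v, hv, h0⟩ := ((hP.spectrum (θ i)).2 ⟨i, rfl⟩).exists_hasEigenvector
  exact smul_left_injective ℝ h0 ((hP.eigen i j v hv).symm.trans (hQ.eigen i j v hv))

theorem HasClassicalParameters.isEigenmatrix_forwardSeq (h : HasClassicalParameters G d b α β)
    (hb : 0 < b) (hθ : ∀ i ≤ d, ∀ j ≤ d,
      classicalEigenvalue d b α β i = classicalEigenvalue d b α β j → i = j) :
    IsEigenmatrix G d (classicalEigenvalue d b α β)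
      (Matrix.of fun i j : Fin (d + 1) => forwardSeq d b α β i j) := by
  classical
  refine ⟨fun i j e => Fin.ext (hθ i (by omega) j (by omega) e), fun μ => ?_,
    fun i j v hv => funext fun x => ?_⟩
  · have e : (∃ i : Fin (d + 1), classicalEigenvalue d b α β i = μ) ↔
        ∃ i ≤ d, classicalEigenvalue d b α β i = μ :=
      ⟨fun ⟨i, hi⟩ => ⟨i, by omega, hi⟩, fun ⟨i, hi, e⟩ => ⟨⟨i, by omega⟩, e⟩⟩
    rw [e]
    convert h.hasEigenvalue_iff hb hθ μ
  · have := (h.isEigenSeq (mem_eigenspace_adjMatrix.1 hv) x).eq_forwardSeq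
      (fun j hj hjd => h.classicalC_pos hj hjd) j (by omega)
    rw [h.connected.distMatrix_zero_mulVec] at this
    exact this

theorem HasClassicalParameters.exists_isEigenSeq (h : HasClassicalParameters G d b α β)
    {P : Matrix (Fin (d + 1)) (Fin (d + 1)) ℝ}
    (hP : IsEigenmatrix G d (classicalEigenvalue d b α β) P) (i : Fin (d + 1)) :
    ∃ S : ℕ → ℝ, S 0 = 1 ∧ IsEigenSeq d b α β (classicalEigenvalue d b α β i) S ∧
      ∀ j : Fin (d + 1), P i j = S j := by
  classical
  obtain ⟨v, h0, hPv, hv⟩ := hP.exists_eigenvector i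
  obtain ⟨x, hx⟩ := Function.ne_iff.1 h0
  have hx : v x ≠ 0 := hx
  have hS := h.isEigenSeq (fun y => hv y) x
  refine ⟨fun j => (distMatrix G j).mulVec v x / v x, ?_, ⟨?_, fun j => ?_, ?_⟩, fun j => ?_⟩
  · simp only [h.connected.distMatrix_zero_mulVec, div_self hx]
  · have := hS.zero
    field_simp
    linear_combination this
  · have := hS.succ j
    field_simp
    linear_combination this
  · simp only [hS.vanish, zero_div]
  · simp only [hPv j, Pi.smul_apply, smul_eq_mul]
    field_simp

theorem IsEigenmatrix.congr {θ θ' : ℕ → ℝ} {P : Matrix (Fin (d + 1)) (Fin (d + 1)) ℝ}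
    (h : IsEigenmatrix G d θ P) (e : ∀ i ≤ d, θ i = θ' i) : IsEigenmatrix G d θ' P := by
  have e : ∀ i : Fin (d + 1), θ i = θ' i := fun i => e i (by omega)
  refine ⟨fun i j => ?_, fun μ => ?_, fun i j => ?_⟩
  · rw [← e, ← e]; exact h.distinct i j
  · simp only [← e]; exact h.spectrum μ
  · rw [← e]; exact h.eigen i j

/-- If b ≤ 0: b_1 > 0 forces [d] > 1, while c_2 > 0 and a_2 ≥ 0 force b > -1. But then b^d ≥ b, and
(b-1)([d]-1) = b^d - b ≥ 0 gives [d] ≤ 1. -/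
theorem HasClassicalParameters.base_pos (h : HasClassicalParameters G d b α β) (hd : 2 ≤ d)
    (h1 : α < β) (h2 : 1 - α * (gaussNum b d - gaussNum b 2 - 1) < β) : 0 < b := by
  by_contra! hb
  have hB := h.classicalB_pos (show 1 < d by omega)
  have hC := h.classicalC_pos (i := 2) (by omega) hd
  have hA := h.classicalA_nonneg hd
  rw [classicalB, gaussNum_one, mul_one] at hB
  have hg : 0 < gaussNum b d - 1 := pos_of_mul_pos_left hB (by linarith)
  have hC2 : 1 + b ≠ 0 := by
    rintro h0
    simp [classicalC, gaussNum_two, h0] at hC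
  have hA2 : classicalA d b α β 2 =
      (1 + b) * (β - (1 - α * (gaussNum b d - gaussNum b 2 - 1))) := by
    simp only [classicalA, classicalB, classicalC, gaussNum_zero, gaussNum_two,
      Nat.add_one_sub_one, gaussNum_one]
    ring
  rw [hA2] at hA
  have hb1 : 0 < 1 + b :=
    lt_of_le_of_ne (nonneg_of_mul_nonneg_left hA (by linarith)) hC2.symm
  obtain ⟨k, rfl⟩ := Nat.exists_eq_add_of_le hd
  have hpow := pow_eq_gaussNum b (2 + k)
  have habs : |b ^ (2 + k)| ≤ |b| := by
    rw [abs_pow]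
    exact pow_le_of_le_one (abs_nonneg b) (abs_le.2 ⟨by linarith, by linarith⟩) (by omega)
  rw [abs_of_nonpos hb] at habs
  have := (abs_le.1 habs).1
  nlinarith

end Eigenmatrix

/-! ### Assembly. -/

/-- The conclusion about the eigenmatrices of graphs with given classical parameters, for a
positive base and all large `β`. -/
theorem exists_bound_of_base_pos (d : ℕ) {b : ℝ} (hb : 0 < b) (α : ℝ) :
    ∃ β₀ : ℝ, ∀ β : ℝ, β₀ ≤ β →
      ∀ (V : Type*) [Fintype V] (G : SimpleGraph V), HasClassicalParameters G d b α β →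
        (∃! P : Matrix (Fin (d + 1)) (Fin (d + 1)) ℝ,
          IsEigenmatrix G d (classicalEigenvalue d b α β) P) ∧
        ∀ P : Matrix (Fin (d + 1)) (Fin (d + 1)) ℝ,
          IsEigenmatrix G d (classicalEigenvalue d b α β) P →
            (∀ i j : Fin (d + 1), 0 < (-1 : ℝ) ^ ((i : ℕ) + j - d) * P i j) ∧
            (∀ m j : Fin (d + 1), 0 < (j : ℕ) → (m : ℕ) + j = d + 1 →
              IsLeast (Set.range fun i : Fin (d + 1) => P i j) (P m j)) ∧
            (∀ (i : Fin d) (j : Fin (d + 1)), 0 < (j : ℕ) →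
              |P i.succ j| < |P i.castSucc j|) := by
  -- The c_j are free of β: if one of them fails to be positive, no graph occurs for any β.
  by_cases hC : ∀ j, 0 < j → j ≤ d → 0 < classicalC b α j
  swap
  · exact ⟨0, fun β _ V _ G h => absurd (fun j hj hjd => h.classicalC_pos hj hjd) hC⟩
  obtain ⟨β₀, hβ₀⟩ := eventually_atTop.1 ((eventually_eq_stableEntry hb hC).and
    ((eventually_stableEntry_sign hb hC).and ((eventually_stableEntry_min hb hC).and
      ((eventually_stableEntry_abs_lt hb hC).and (eventually_classicalEigenvalue_injOn α d hb)))))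
  refine ⟨β₀, fun β hβ V _ G h => ?_⟩
  obtain ⟨hS, hsign, hmin, habs, hθ⟩ := hβ₀ β hβ
  refine ⟨⟨_, h.isEigenmatrix_forwardSeq hb hθ, fun Q hQ =>
    hQ.unique (h.isEigenmatrix_forwardSeq hb hθ)⟩, fun P hP => ?_⟩
  have e : ∀ i j : Fin (d + 1), P i j = stableEntry d b α β i j := by
    intro i j
    obtain ⟨S, hS0, hSe, hPS⟩ := h.exists_isEigenSeq hP i
    rw [hPS, hS i (by omega) S hS0 hSe j (by omega)]
  refine ⟨fun i j => ?_, fun m j hj hm => ⟨⟨m, rfl⟩, ?_⟩, fun i j hj => ?_⟩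
  · rw [e]
    exact hsign i (by omega) j (by omega)
  · rintro _ ⟨i, rfl⟩
    simp only [e]
    rw [show (m : ℕ) = d + 1 - j by omega]
    exact hmin i (by omega) j (by omega) hj
  · rw [e, e]
    exact habs i (by omega) j (by omega) i.2 hj

theorem mainTheorem5 (d : ℕ) (b α : ℝ) :
    ∃ β₀ : ℝ, ∀ β : ℝ, β₀ ≤ β →
      ∀ (V : Type*) [Fintype V] (G : SimpleGraph V), HasClassicalParameters G d b α β →
        (∃! P : Matrix (Fin (d + 1)) (Fin (d + 1)) ℝ,
          IsEigenmatrix G d (classicalEigenvalue d b α β) P) ∧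
        ∀ P : Matrix (Fin (d + 1)) (Fin (d + 1)) ℝ,
          IsEigenmatrix G d (classicalEigenvalue d b α β) P →
            (∀ i j : Fin (d + 1), (i : ℕ) + j ≤ d → 0 < P i j) ∧
            (∀ i j : Fin (d + 1), d ≤ (i : ℕ) + j → 0 < (-1 : ℝ) ^ ((i : ℕ) + j - d) * P i j) ∧
            (∀ m j : Fin (d + 1), 0 < (j : ℕ) → (m : ℕ) + j = d + 1 →
              IsLeast (Set.range fun i : Fin (d + 1) => P i j) (P m j)) ∧
            (1 ≤ b → ∀ (i : Fin d) (j : Fin (d + 1)), 0 < (j : ℕ) →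
              |P i.succ j| < |P i.castSucc j|) := by
  obtain ⟨b', hb', hred⟩ : ∃ b' : ℝ, 0 < b' ∧ (b' = b ∨ d ≤ 1 ∨ (2 ≤ d ∧ b ≤ 0)) := by
    rcases lt_or_ge 0 b with hb | hb
    · exact ⟨b, hb, Or.inl rfl⟩
    · exact ⟨1, one_pos, Or.inr ((le_or_gt d 1).imp_right fun hd => ⟨hd, hb⟩)⟩
  obtain ⟨β₀, hβ₀⟩ := exists_bound_of_base_pos d hb' α
  -- The last two bounds exceed by 1 the strict thresholds in `HasClassicalParameters.base_pos`.
  refine ⟨max β₀ (max (α + 1) (2 - α * (gaussNum b d - gaussNum b 2 - 1))),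
    fun β hβ V _ G h => ?_⟩
  obtain ⟨hβ, hβ1, hβ2⟩ : β₀ ≤ β ∧ α + 1 ≤ β ∧
      2 - α * (gaussNum b d - gaussNum b 2 - 1) ≤ β := by simpa using hβ
  obtain ⟨h', hθ⟩ : HasClassicalParameters G d b' α β ∧
      ∀ i ≤ d, classicalEigenvalue d b' α β i = classicalEigenvalue d b α β i := by
    rcases hred with rfl | hd | ⟨hd, hb⟩
    · exact ⟨h, fun _ _ => rfl⟩
    · exact ⟨h.congr_of_le_one hd b', fun i hi =>
        classicalEigenvalue_congr_of_le_one hd _ _ _ _ hi⟩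
    · exact absurd (h.base_pos hd (by linarith) (by linarith)) hb.not_gt
  obtain ⟨⟨P₀, hP₀, -⟩, hall⟩ := hβ₀ β hβ V G h'
  refine ⟨⟨P₀, hP₀.congr hθ, fun Q hQ => hQ.unique (hP₀.congr hθ)⟩, fun P hP => ?_⟩
  obtain ⟨h1, h2, h3⟩ := hall P (hP.congr fun i hi => (hθ i hi).symm)
  refine ⟨fun i j hij => ?_, fun i j _ => h1 i j, h2, fun _ => h3⟩
  have := h1 i j
  rwa [Nat.sub_eq_zero_of_le hij, pow_zero, one_mul] at this
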